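/- **Setting.** Let $n,p\in\mathbb N$ and give $\mathbb R^p,\mathbb R^n$ the Euclidean norms. Let $X:\mathbb R^p\to\mathbb R^n$ be a nonzero linear map with operator norm $\|X\|$, let $R:\mathbb R^p\to\mathbb R\cup\{+\infty\}$ be proper, convex and lower semicontinuous, let $\alpha>0$, and put $R_\alpha(w)=R(w)+\frac\alpha2\|w\|^2$. For data $y\in\mathbb R^n$ consider the problem $\min_w R_\alpha(w)$ subject to $Xw=y$, and its dual $\min_v\,\{R_\alpha^*(-X^\top v)+\langle y,v\rangle\}$. Dual gradient descent (DGD) with data $y$ is $$v^{(0)}=0,\qquad w^{(k)}=\mathrm{prox}_{\alpha^{-1}R}\big(-\alpha^{-1}X^\top v^{(k)}\big),\qquad v^{(k+1)}=v^{(k)}+\gamma\,(Xw^{(k)}-y),\qquad \gamma=\alpha\|X\|^{-2}.$$ **Partial smoothness.** $R$ is partly smooth at $w^\dagger$ relative to a set $\mathcal M\subset\mathbb R^p$ if $\partial R(w^\dagger)\neq\emptyset$ and: (smoothness) $w^\dagger\in\mathcal M$, near $w^\dagger$ the set $\mathcal M$ is the zero set of a $C^2$ map with surjective derivative at $w^\dagger$,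 and near $w^\dagger$ the function $R$ agrees on $\mathcal M$ with a $C^2$ function; (sharpness) the tangent space of $\mathcal M$ at $w^\dagger$ is the orthogonal complement of the linear space parallel to the affine hull of $\partial R(w^\dagger)$; (continuity) at every point of $\mathcal M$ near $w^\dagger$, the set-valued map $\partial R$ is continuous along $\mathcal M$ (inner and outer semicontinuous, in the sense of Painlevé–Kuratowski). **Theorem 4.1 (Model consistency of DGD).** Let $w^\dagger\in\mathbb R^p$, $y^\dagger=Xw^\dagger$, $v^\dagger\in\mathbb R^n$, $z^\dagger=-X^\top v^\dagger$, $\mathcal M_{w^\dagger}\subset\mathbb R^p$ and $\epsilon>0$. Assume: 1. $w^\dagger$ is the unique solution of the problem with data $y^\dagger$, $v^\dagger$ is a solution of the dual problem with data $y^\dagger$, and the dual DGD iterates $v_0^{(k)}$ with data $y^\dagger$ converge to $v^\dagger$; 2. $z^\dagger\in\mathrm{ri}\,\partial R_\alpha(w^\dagger)$; 3. $R$ is partly smooth at $w^\dagger$ relative to $\mathcal M_{w^\dagger}$; 4. $\kappa\in\mathbb R$ satisfies $\kappa<\mathrm{dist}\big(w^\dagger+z^\dagger,\mathrm{bdy}(\mathcal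 U_\epsilon)\big)$, where $\mathcal U_\epsilon=\bigcup_{w\in\mathcal M_{w^\dagger},\,\|w-w^\dagger\|<\epsilon}\big(w+\partial R_\alpha(w)\big)$ (and $\mathrm{dist}(\cdot,\emptyset)=+\infty$). Let $c>0$. Then there is $\delta_0>0$ such that the following holds for every $\delta\in(0,\delta_0)$, every $y_\delta\in\mathbb R^n$ with $\|y_\delta-y^\dagger\|\le\delta$, and every stopping time $k_\delta\in\{\lfloor c\delta^{-1}\rfloor,\dots,2\lfloor c\delta^{-1}\rfloor\}$ whose constant $c_\delta$, defined by $k_\delta=c_\delta\delta^{-1}$, satisfies $\alpha c_\delta\|X\|^{-1}\le\kappa$. Let $w_\delta^{(k)}$ be the DGD iterates with data $y_\delta$. Then $$w_\delta^{(k_\delta)}\in\mathcal M_{w^\dagger},$$ and there are integers $0<\underline k<k_\delta<\overline k$ such that $w_\delta^{(k)}\in\mathcal M_{w^\dagger}$ for all integers $k\in[\underline k,\overline k]$. -/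

import Mathlib

open Filter Topology

noncomputable section

namespace DGD

/-- `R ∈ Γ₀(E)`: an extended-real-valued function that is proper (never `-∞`, not identically
`+∞`), convex (its epigraph is convex) and lower semicontinuous. -/
structure IsGammaZero {E : Type*} [NormedAddCommGroup E] [InnerProductSpace ℝ E]
    (R : E → EReal) : Prop where
  ne_bot : ∀ w, R w ≠ ⊥
  exists_ne_top : ∃ w, R w ≠ ⊤
  convex_epigraph : Convex ℝ {q : E × ℝ | R q.1 ≤ (q.2 : EReal)}
  lsc : LowerSemicontinuous R

/-- The subdifferential of `R` at `w`; it is empty outside the domain of `R`. -/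
def subdiff {E : Type*} [NormedAddCommGroup E] [InnerProductSpace ℝ E]
    (R : E → EReal) (w : E) : Set E :=
  {u | R w ≠ ⊤ ∧ ∀ w', R w + ((inner ℝ u (w' - w) : ℝ) : EReal) ≤ R w'}

/-- The Fenchel conjugate `R*(u) = sup_w (⟨u, w⟩ - R(w))`. -/
def conj {E : Type*} [NormedAddCommGroup E] [InnerProductSpace ℝ E]
    (R : E → EReal) (u : E) : EReal :=
  ⨆ w, (((inner ℝ u w : ℝ) : EReal) - R w)

/-- The proximity operator `prox_{γR}(x)`: the minimizer of `R(w) + ‖w - x‖² / (2γ)`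
(which exists and is unique when `R ∈ Γ₀(E)`, `E` is finite-dimensional and `γ > 0`). -/
def prox {E : Type*} [NormedAddCommGroup E] [InnerProductSpace ℝ E]
    (γ : ℝ) (R : E → EReal) (x : E) : E :=
  Classical.epsilon fun w =>
    ∀ w', R w + ((1 / (2 * γ) * ‖w - x‖ ^ 2 : ℝ) : EReal)
      ≤ R w' + ((1 / (2 * γ) * ‖w' - x‖ ^ 2 : ℝ) : EReal)

/-- The strongly convex regularizer `R_α(w) = R(w) + (α / 2) ‖w‖²`. -/
def regularized {E : Type*} [NormedAddCommGroup E] [InnerProductSpace ℝ E]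
    (α : ℝ) (R : E → EReal) (w : E) : EReal :=
  R w + ((α / 2 * ‖w‖ ^ 2 : ℝ) : EReal)

/-- `M` is a `C²` manifold around `w`: `w ∈ M`, and near `w` the set `M` is the zero set of a
`C²` map with surjective derivative at `w`. -/
def IsC2ManifoldAround {E : Type*} [NormedAddCommGroup E] [InnerProductSpace ℝ E]
    (M : Set E) (w : E) : Prop :=
  w ∈ M ∧ ∃ (m : ℕ) (Φ : E → EuclideanSpace ℝ (Fin m)),
    ContDiffAt ℝ 2 Φ w ∧ Function.Surjective (fderiv ℝ Φ w) ∧ ∀ᶠ x in 𝓝 w, (x ∈ M ↔ Φ x = 0)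

/-- The tangent space of the manifold `M` at `w`: all velocities at `w` of `C²` curves in `M`. -/
def tangentSpaceAt {E : Type*} [NormedAddCommGroup E] [InnerProductSpace ℝ E]
    (M : Set E) (w : E) : Set E :=
  {d | ∃ c : ℝ → E, c 0 = w ∧ ContDiffAt ℝ 2 c 0 ∧ HasDerivAt c d 0 ∧ ∀ᶠ t in 𝓝 (0 : ℝ), c t ∈ M}

/-- The model tangent subspace: the orthogonal complement of the linear space
parallel to the affine hull of the subdifferential. -/
def modelTangent {E : Type*} [NormedAddCommGroup E] [InnerProductSpace ℝ E]
    (R : E → EReal) (w : E) : Submodule ℝ E :=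
  (vectorSpan ℝ (subdiff R w))ᗮ

/-- Continuity (in the sense of Painlevé and Kuratowski) of a set-valued map `S` at `w` along `M`:
every point of `S w` is a limit of points of `S w'` as `w' → w` in `M` (inner semicontinuity), and
every cluster point of such points lies in `S w` (outer semicontinuity). -/
structure SetValuedContinuousAlong {E : Type*} [NormedAddCommGroup E] [InnerProductSpace ℝ E]
    (S : E → Set E) (M : Set E) (w : E) : Prop where
  inner_sc : ∀ u ∈ S w, ∀ V ∈ 𝓝 u, ∀ᶠ w' in 𝓝[M] w, (S w' ∩ V).Nonempty
  outer_sc : ∀ u, (∀ V ∈ 𝓝 u, ∃ᶠ w' in 𝓝[M] w, (S w' ∩ V).Nonempty) → u ∈ S w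

/-- `R` is partly smooth at `w` relative to `M`. -/
structure IsPartlySmooth {E : Type*} [NormedAddCommGroup E] [InnerProductSpace ℝ E]
    (R : E → EReal) (M : Set E) (w : E) : Prop where
  nonempty_subdiff : (subdiff R w).Nonempty
  manifold : IsC2ManifoldAround M w
  smooth : ∃ f : E → ℝ, ContDiffAt ℝ 2 f w ∧ ∀ᶠ x in 𝓝[M] w, R x = (f x : EReal)
  sharp : tangentSpaceAt M w = (modelTangent R w : Set E)
  continuous : ∀ᶠ x in 𝓝[M] w, SetValuedContinuousAlong (subdiff R) M x

/-- The solutions of `min R_α(w)` subject to `X w = y`. -/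
def primalSolutions {E F : Type*} [NormedAddCommGroup E] [InnerProductSpace ℝ E]
    [NormedAddCommGroup F] [InnerProductSpace ℝ F]
    (X : E →L[ℝ] F) (R : E → EReal) (α : ℝ) (y : F) : Set E :=
  {w | X w = y ∧ regularized α R w ≠ ⊤ ∧
    ∀ w', X w' = y → regularized α R w ≤ regularized α R w'}

/-- The dual objective `φ(v) = R_α*(-Xᵀ v) + ⟨y, v⟩`. -/
def dualObjective {E F : Type*} [NormedAddCommGroup E] [InnerProductSpace ℝ E] [CompleteSpace E]
    [NormedAddCommGroup F] [InnerProductSpace ℝ F] [CompleteSpace F]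
    (X : E →L[ℝ] F) (R : E → EReal) (α : ℝ) (y : F) (v : F) : EReal :=
  conj (regularized α R) (-(X.adjoint v)) + ((inner ℝ y v : ℝ) : EReal)

/-- The solutions of the dual problem `min φ(v)`. -/
def dualSolutions {E F : Type*} [NormedAddCommGroup E] [InnerProductSpace ℝ E] [CompleteSpace E]
    [NormedAddCommGroup F] [InnerProductSpace ℝ F] [CompleteSpace F]
    (X : E →L[ℝ] F) (R : E → EReal) (α : ℝ) (y : F) : Set F :=
  {v | ∀ v', dualObjective X R α y v ≤ dualObjective X R α y v'}

/-- The primal point `prox_{α⁻¹R}(α⁻¹ z)`, with `z = -Xᵀ v`, that belongs to a dual variable `v`. -/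
def primalOfDual {E F : Type*} [NormedAddCommGroup E] [InnerProductSpace ℝ E] [CompleteSpace E]
    [NormedAddCommGroup F] [InnerProductSpace ℝ F] [CompleteSpace F]
    (X : E →L[ℝ] F) (R : E → EReal) (α : ℝ) (v : F) : E :=
  prox α⁻¹ R (α⁻¹ • (-(X.adjoint v)))

/-- The dual iterates `v⁽ᵏ⁾` of dual gradient descent for the data `y`, with step size
`γ = α ‖X‖⁻²` and `v⁽⁰⁾ = 0`. -/
def dgdDual {E F : Type*} [NormedAddCommGroup E] [InnerProductSpace ℝ E] [CompleteSpace E]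
    [NormedAddCommGroup F] [InnerProductSpace ℝ F] [CompleteSpace F]
    (X : E →L[ℝ] F) (R : E → EReal) (α : ℝ) (y : F) : ℕ → F
  | 0 => 0
  | k + 1 => dgdDual X R α y k +
      (α * (‖X‖ ^ 2)⁻¹) • (X (primalOfDual X R α (dgdDual X R α y k)) - y)

/-- The primal iterates `w⁽ᵏ⁾` of dual gradient descent for the data `y`. -/
def dgdPrimal {E F : Type*} [NormedAddCommGroup E] [InnerProductSpace ℝ E] [CompleteSpace E]
    [NormedAddCommGroup F] [InnerProductSpace ℝ F] [CompleteSpace F]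
    (X : E →L[ℝ] F) (R : E → EReal) (α : ℝ) (y : F) (k : ℕ) : E :=
  primalOfDual X R α (dgdDual X R α y k)

/-- The local union `𝒰_ε` of the sets `w + ∂R_α(w)` over the points `w` of `M` with
`‖w - w₀‖ < ε`. -/
def localUnion {E : Type*} [NormedAddCommGroup E] [InnerProductSpace ℝ E]
    (R : E → EReal) (α : ℝ) (M : Set E) (w₀ : E) (ε : ℝ) : Set E :=
  ⋃ w ∈ M ∩ Metric.ball w₀ ε, (fun u => w + u) '' subdiff (regularized α R) w

end DGD

end

/-! Strong convexity of R_α makes the dual gradient map v ↦ w(v) cocoercive, so a dual gradient step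
of length α‖X‖⁻² is nonexpansive. A data error δ therefore shifts the k-th dual iterate by at most
kαδ/‖X‖², and its image under Xᵀ by at most kαδ/‖X‖, which is αc_δ/‖X‖ ≤ κ at the stopping time.
Since the noiseless dual iterates converge, -Xᵀv⁽ᵏ⁾ lies within κ + o(1) of z†.

This dual drift need not vanish, but the primal error does. Over O(1/δ) steps the dual iterates stay
bounded and the squared residuals have a bounded sum. The residuals are essentially monotone, so the
one at k ~ 1/δ is O(√δ), and cocoercivity turns this into w⁽ᵏ⁾ → w†
(`eventually_norm_dgdPrimal_sub_le`).

Hence w⁽ᵏ⁾ - Xᵀv⁽ᵏ⁾ is closer to w† + z† than the boundary of 𝒰_ε and lies in 𝒰_ε. The sets w +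
∂R_α(w) are disjoint for distinct w, so w⁽ᵏ⁾ ∈ M
(`IsGammaZero.mem_of_edist_lt_frontier_localUnion`). The slack below the boundary also covers the
neighbours k_δ ± 1. -/

namespace DGD

/-! ### Strong monotonicity, the proximity operator and the local union. -/

section ConvexAnalysis

variable {E : Type*} [NormedAddCommGroup E] [InnerProductSpace ℝ E]

theorem exists_coe_eq {E : Type*} {R : E → EReal} (hbot : ∀ w, R w ≠ ⊥) {w : E} (h : R w ≠ ⊤) :
    ∃ r : ℝ, R w = r :=
  ⟨(R w).toReal, (EReal.coe_toReal h (hbot w)).symm⟩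

/-- Membership in the subdifferential in terms of the finite values of the function. -/
theorem mem_subdiff_iff {R : E → EReal} (hbot : ∀ w, R w ≠ ⊥) {w u : E} :
    u ∈ subdiff R w ↔ ∃ r : ℝ, R w = r ∧
      ∀ (w' : E) (r' : ℝ), R w' = r' → r + inner ℝ u (w' - w) ≤ r' := by
  constructor
  · rintro ⟨htop, h⟩
    obtain ⟨r, hr⟩ := exists_coe_eq hbot htop
    refine ⟨r, hr, fun w' r' hr' => ?_⟩
    have := h w'
    rw [hr, hr'] at this
    exact_mod_cast this
  · rintro ⟨r, hr, h⟩
    refine ⟨by simp [hr], fun w' => ?_⟩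
    by_cases htop : R w' = ⊤
    · simp [htop]
    · obtain ⟨r', hr'⟩ := exists_coe_eq hbot htop
      rw [hr, hr']
      exact_mod_cast h w' r' hr'

theorem regularized_ne_bot {R : E → EReal} (hbot : ∀ w, R w ≠ ⊥) (α : ℝ) (w : E) :
    regularized α R w ≠ ⊥ := by
  simp only [regularized, ne_eq, EReal.add_eq_bot_iff, not_or]
  exact ⟨hbot w, EReal.coe_ne_bot _⟩

theorem regularized_eq_coe {R : E → EReal} {w : E} {r : ℝ} (h : R w = r) (α : ℝ) :
    regularized α R w = ((r + α / 2 * ‖w‖ ^ 2 : ℝ) : EReal) := by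
  rw [regularized, h]; norm_cast

theorem eq_coe_of_regularized_eq_coe {R : E → EReal} (hbot : ∀ w, R w ≠ ⊥) {α : ℝ} {w : E}
    {s : ℝ} (h : regularized α R w = s) : R w = ((s - α / 2 * ‖w‖ ^ 2 : ℝ) : EReal) := by
  have htop : R w ≠ ⊤ := by
    intro htop
    rw [regularized, htop, EReal.top_add_coe] at h
    exact EReal.coe_ne_top _ h.symm
  obtain ⟨r, hr⟩ := exists_coe_eq hbot htop
  rw [regularized_eq_coe hr] at h
  rw [hr, ← EReal.coe_eq_coe_iff.1 h]
  simp

theorem IsGammaZero.le_convexCombination {R : E → EReal} (hR : IsGammaZero R) {w w' : E}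
    {r r' : ℝ} (hr : R w = r) (hr' : R w' = r') {t : ℝ} (h0 : 0 ≤ t) (h1 : t ≤ 1) :
    R (w + t • (w' - w)) ≤ ((r + t * (r' - r) : ℝ) : EReal) := by
  have h := hR.convex_epigraph.add_smul_sub_mem (x := (w, r)) (y := (w', r'))
    hr.le hr'.le ⟨h0, h1⟩
  simpa using h

/-- The inclusion `∂R_α(w) ⊆ ∂R(w) + α w`. -/
theorem IsGammaZero.sub_smul_mem_subdiff {R : E → EReal} (hR : IsGammaZero R) {α : ℝ}
    {w z : E} (hz : z ∈ subdiff (regularized α R) w) :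
    z - α • w ∈ subdiff R w := by
  obtain ⟨s, hs, h⟩ := (mem_subdiff_iff (regularized_ne_bot hR.ne_bot α)).1 hz
  obtain ⟨r, hr⟩ : ∃ r : ℝ, R w = r := ⟨_, eq_coe_of_regularized_eq_coe hR.ne_bot hs⟩
  have hsr : r + α / 2 * ‖w‖ ^ 2 = s := by
    rw [regularized_eq_coe hr] at hs
    exact_mod_cast hs
  refine (mem_subdiff_iff hR.ne_bot).2 ⟨r, hr, fun w' r' hr' => ?_⟩
  set d := w' - w with hd
  -- Convexity of R bounds the subgradient inequality of R_α at w + t d; after division by t, only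
  -- the quadratic term keeps a factor t, and it vanishes as t → 0.
  have key : ∀ t : ℝ, 0 < t → t ≤ 1 →
      r + inner ℝ (z - α • w) d ≤ r' + t * (α / 2 * ‖d‖ ^ 2) := by
    intro t h0 h1
    have hle := hR.le_convexCombination hr hr' h0.le h1
    obtain ⟨q, hq⟩ := exists_coe_eq hR.ne_bot (ne_top_of_le_ne_top (EReal.coe_ne_top _) hle)
    rw [← hd] at hle hq
    rw [hq, EReal.coe_le_coe_iff] at hle
    have hsub := h _ _ (regularized_eq_coe hq α)
    rw [add_sub_cancel_left, inner_smul_right, norm_add_sq_real, norm_smul, inner_smul_right,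
      mul_pow, Real.norm_eq_abs, sq_abs] at hsub
    rw [inner_sub_left, inner_smul_left]
    simp only [conj_trivial]
    refine le_of_mul_le_mul_left ?_ h0
    nlinarith
  refine le_of_tendsto_of_tendsto tendsto_const_nhds
    (f := fun _ : ℝ => r + inner ℝ (z - α • w) d)
    (g := fun t : ℝ => r' + t * (α / 2 * ‖d‖ ^ 2)) (b := 𝓝[>] 0) ?_ ?_
  · have : Continuous fun t : ℝ => r' + t * (α / 2 * ‖d‖ ^ 2) := by fun_prop
    simpa using (this.tendsto 0).mono_left nhdsWithin_le_nhds
  · filter_upwards [Ioc_mem_nhdsGT (zero_lt_one' ℝ)] with t ht using key t ht.1 ht.2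

/-- The subdifferential of `R_α` is strongly monotone with constant `α`. -/
theorem IsGammaZero.strongly_monotone {R : E → EReal} (hR : IsGammaZero R) {α : ℝ}
    {w w' z z' : E} (hz : z ∈ subdiff (regularized α R) w)
    (hz' : z' ∈ subdiff (regularized α R) w') :
    α * ‖w - w'‖ ^ 2 ≤ inner ℝ (z - z') (w - w') := by
  obtain ⟨r, hr, h⟩ := (mem_subdiff_iff hR.ne_bot).1 (hR.sub_smul_mem_subdiff hz)
  obtain ⟨r', hr', h'⟩ := (mem_subdiff_iff hR.ne_bot).1 (hR.sub_smul_mem_subdiff hz')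
  have h1 := h w' r' hr'
  have h2 := h' w r hr
  rw [← real_inner_self_eq_norm_sq]
  simp only [inner_sub_left, inner_sub_right, inner_smul_left, conj_trivial] at h1 h2 ⊢
  linarith

/-- The objective of the proximity operator attains its minimum. -/
theorem IsGammaZero.exists_prox_minimizer [ProperSpace E] {R : E → EReal} (hR : IsGammaZero R)
    {w₀ u₀ : E} (hu₀ : u₀ ∈ subdiff R w₀) {b : ℝ} (hb : 0 < b) (x : E) :
    ∃ w, ∀ w', R w + ((b * ‖w - x‖ ^ 2 : ℝ) : EReal) ≤ R w' + ((b * ‖w' - x‖ ^ 2 : ℝ) : EReal) := by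
  obtain ⟨r₀, hr₀, h₀⟩ := (mem_subdiff_iff hR.ne_bot).1 hu₀
  set f : E → EReal := fun w => R w + ((b * ‖w - x‖ ^ 2 : ℝ) : EReal) with hf
  have hlsc : LowerSemicontinuous f := by
    refine hR.lsc.add' ?_ fun w => EReal.continuousAt_add (.inr (EReal.coe_ne_bot _))
      (.inr (EReal.coe_ne_top _))
    exact (continuous_coe_real_ereal.comp (by fun_prop)).lowerSemicontinuous
  -- Beyond this radius b‖w' - w₀‖² absorbs both linear terms, from the affine minorant with slope
  -- u₀ and from the expanded square, so the objective is at least its value at w₀.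
  set ρ : ℝ := b⁻¹ * (‖u₀‖ + 2 * b * ‖w₀ - x‖) with hρ
  have hρ0 : 0 ≤ ρ := by positivity
  obtain ⟨w, -, hmin⟩ := LowerSemicontinuousOn.exists_isMinOn
    (Metric.nonempty_closedBall.2 hρ0) (isCompact_closedBall w₀ ρ)
    (hlsc.lowerSemicontinuousOn (Metric.closedBall w₀ ρ))
  refine ⟨w, fun w' => ?_⟩
  by_cases hw' : w' ∈ Metric.closedBall w₀ ρ
  · exact hmin hw'
  refine (hmin (Metric.mem_closedBall_self hρ0)).trans ?_
  by_cases htop : R w' = ⊤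
  · rw [htop, EReal.top_add_coe]; exact le_top
  obtain ⟨r', hr'⟩ := exists_coe_eq hR.ne_bot htop
  simp only [hf]
  rw [hr₀, hr']
  have h1 := h₀ w' r' hr'
  have hfar : ρ < ‖w' - w₀‖ := by simpa [dist_eq_norm] using hw'
  have h2 : ‖u₀‖ + 2 * b * ‖w₀ - x‖ ≤ b * ‖w' - w₀‖ := by
    have := mul_le_mul_of_nonneg_left hfar.le hb.le
    rwa [hρ, mul_inv_cancel_left₀ hb.ne'] at this
  have h3 : -(‖u₀‖ * ‖w' - w₀‖) ≤ inner ℝ u₀ (w' - w₀) :=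
    (abs_le.1 (abs_real_inner_le_norm _ _)).1
  have h4 : -(‖w' - w₀‖ * ‖w₀ - x‖) ≤ inner ℝ (w' - w₀) (w₀ - x) :=
    (abs_le.1 (abs_real_inner_le_norm _ _)).1
  have h5 : ‖w' - x‖ ^ 2 =
      ‖w' - w₀‖ ^ 2 + 2 * inner ℝ (w' - w₀) (w₀ - x) + ‖w₀ - x‖ ^ 2 := by
    rw [← norm_add_sq_real, sub_add_sub_cancel]
  have h6 := mul_le_mul_of_nonneg_right h2 (norm_nonneg (w' - w₀))
  have h7 := mul_le_mul_of_nonneg_left h4 hb.le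
  have : r₀ + b * ‖w₀ - x‖ ^ 2 ≤ r' + b * ‖w' - x‖ ^ 2 := by
    rw [h5]; linarith
  exact_mod_cast this

/-- The optimality condition of the proximity operator `prox_{α⁻¹R}`. -/
theorem IsGammaZero.mem_subdiff_prox [ProperSpace E] {R : E → EReal} (hR : IsGammaZero R)
    {w₀ u₀ : E} (hu₀ : u₀ ∈ subdiff R w₀) {α : ℝ} (hα : 0 < α) (z : E) :
    z ∈ subdiff (regularized α R) (prox α⁻¹ R (α⁻¹ • z)) := by
  have hb : 0 < 1 / (2 * α⁻¹) := by positivity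
  have hmin : ∀ w', R (prox α⁻¹ R (α⁻¹ • z)) +
      ((1 / (2 * α⁻¹) * ‖prox α⁻¹ R (α⁻¹ • z) - α⁻¹ • z‖ ^ 2 : ℝ) : EReal) ≤
        R w' + ((1 / (2 * α⁻¹) * ‖w' - α⁻¹ • z‖ ^ 2 : ℝ) : EReal) :=
    Classical.epsilon_spec (hR.exists_prox_minimizer hu₀ hb (α⁻¹ • z))
  set w := prox α⁻¹ R (α⁻¹ • z)
  have hb' : 1 / (2 * α⁻¹) = α / 2 := by field_simp
  rw [hb'] at hmin
  have htop : R w ≠ ⊤ := by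
    intro htop
    have := hmin w₀
    rw [htop, EReal.top_add_coe, top_le_iff] at this
    obtain ⟨r₀, hr₀, -⟩ := (mem_subdiff_iff hR.ne_bot).1 hu₀
    rw [hr₀] at this
    exact EReal.coe_ne_top _ this
  obtain ⟨r, hr⟩ := exists_coe_eq hR.ne_bot htop
  refine (mem_subdiff_iff (regularized_ne_bot hR.ne_bot α)).2
    ⟨_, regularized_eq_coe hr α, fun w' s' hs' => ?_⟩
  have hr' := eq_coe_of_regularized_eq_coe hR.ne_bot hs'
  have h := hmin w'
  rw [hr, hr'] at h
  have h : r + α / 2 * ‖w - α⁻¹ • z‖ ^ 2 ≤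
    s' - α / 2 * ‖w'‖ ^ 2 + α / 2 * ‖w' - α⁻¹ • z‖ ^ 2 := by exact_mod_cast h
  -- The prox objective is R_α - ⟨z, ·⟩ plus a constant, so minimality is the subgradient inequality
  -- for z.
  have hexp : ∀ a : E, α / 2 * ‖a - α⁻¹ • z‖ ^ 2 =
      α / 2 * ‖a‖ ^ 2 - inner ℝ z a + α / 2 * ‖α⁻¹ • z‖ ^ 2 := by
    intro a
    rw [norm_sub_sq_real, inner_smul_right, real_inner_comm]
    field_simp
  rw [hexp, hexp] at h
  rw [inner_sub_right]
  linarith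

/-- Points of `w + ∂R_α(w)` determine `w`. -/
theorem IsGammaZero.eq_of_add_eq_add {R : E → EReal} (hR : IsGammaZero R) {α : ℝ} (hα : 0 < α)
    {w w' z z' : E} (hz : z ∈ subdiff (regularized α R) w)
    (hz' : z' ∈ subdiff (regularized α R) w') (h : w + z = w' + z') : w = w' := by
  have hmono := hR.strongly_monotone hz hz'
  -- Strong monotonicity then reads α‖w - w'‖² ≤ -‖w - w'‖².
  have hzz : z - z' = -(w - w') := by
    rw [← sub_eq_zero] at h ⊢
    rw [← h]; abel
  rw [hzz, inner_neg_left, real_inner_self_eq_norm_sq] at hmono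
  have : ‖w - w'‖ ^ 2 = 0 := le_antisymm (by nlinarith [sq_nonneg ‖w - w'‖]) (sq_nonneg _)
  simpa [sub_eq_zero] using this

/-- A ball around a point of `U` that is smaller than the distance to the frontier lies in `U`. -/
theorem mem_of_edist_lt_infEDist_frontier {U : Set E} {x y : E} (hx : x ∈ U)
    (hy : edist x y < Metric.infEDist x (frontier U)) : y ∈ U := by
  by_contra hyU
  have hconn : IsPreconnected (segment ℝ x y) := (convex_segment x y).isPreconnected
  -- Otherwise the interior and the exterior of U would disconnect the segment.
  obtain ⟨q, hq, hqf⟩ : (segment ℝ x y ∩ frontier U).Nonempty := by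
    by_contra hne
    rw [Set.not_nonempty_iff_eq_empty, ← Set.disjoint_iff_inter_eq_empty] at hne
    have hcl : ∀ a ∈ segment ℝ x y, a ∈ U → a ∈ interior U := fun a ha haU => by
      by_contra hai
      exact Set.disjoint_left.1 hne ha ⟨subset_closure haU, hai⟩
    have hcl' : ∀ a ∈ segment ℝ x y, a ∉ U → a ∈ (closure U)ᶜ := fun a ha haU hac =>
      Set.disjoint_left.1 hne ha ⟨hac, fun hai => haU (interior_subset hai)⟩
    obtain ⟨a, -, hai, hac⟩ := hconn (interior U) (closure U)ᶜ isOpen_interior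
      isClosed_closure.isOpen_compl
      (fun a ha => (em (a ∈ U)).imp (hcl a ha) (hcl' a ha))
      ⟨x, left_mem_segment ℝ x y, hcl x (left_mem_segment ℝ x y) hx⟩
      ⟨y, right_mem_segment ℝ x y, hcl' y (right_mem_segment ℝ x y) hyU⟩
    exact hac (subset_closure (interior_subset hai))
  have h1 : Metric.infEDist x (frontier U) ≤ edist x q := Metric.infEDist_le_edist_of_mem hqf
  have h2 : edist x q ≤ edist x y := by
    rw [edist_dist, edist_dist]
    refine ENNReal.ofReal_le_ofReal ?_
    rw [← dist_add_dist_of_mem_segment hq]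
    exact le_add_of_nonneg_right dist_nonneg
  exact absurd hy (not_lt.2 (h1.trans h2))

/-- A primal point whose sum with its dual certificate is closer to `w₀ + z₀` than the frontier of
the local union lies in `M`. -/
theorem IsGammaZero.mem_of_edist_lt_frontier_localUnion (hR : IsGammaZero R) (hα : 0 < α)
    {M : Set E} {w₀ z₀ w z : E} {ε : ℝ} (hε : 0 < ε) (hw₀ : w₀ ∈ M)
    (hz₀ : z₀ ∈ subdiff (regularized α R) w₀) (hz : z ∈ subdiff (regularized α R) w)
    (h : edist (w₀ + z₀) (w + z) <
      Metric.infEDist (w₀ + z₀) (frontier (localUnion R α M w₀ ε))) : w ∈ M := by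
  have h₀ : w₀ + z₀ ∈ localUnion R α M w₀ ε :=
    Set.mem_biUnion (⟨hw₀, Metric.mem_ball_self hε⟩ : w₀ ∈ M ∩ Metric.ball w₀ ε) ⟨z₀, hz₀, rfl⟩
  obtain ⟨w', hw', u, hu, hsum⟩ := Set.mem_iUnion₂.1 (mem_of_edist_lt_infEDist_frontier h₀ h)
  rw [hR.eq_of_add_eq_add hα hz hu hsum.symm]
  exact hw'.1

end ConvexAnalysis

/-! ### Nonexpansive dual steps: stability, boundedness and residuals. -/

section Iteration

variable {E F : Type*} [NormedAddCommGroup E] [InnerProductSpace ℝ E]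
  [NormedAddCommGroup F] [InnerProductSpace ℝ F]

/-- The firm nonexpansiveness of a gradient step with step size `α ‖X‖⁻²`. -/
theorem norm_gradient_step_sq_le {X : E →L[ℝ] F} (hX : X ≠ 0) {α : ℝ} {W : F → E}
    (hW : ∀ v v', α * ‖W v - W v'‖ ^ 2 ≤ inner ℝ (X (W v) - X (W v')) (v' - v))
    (hα : 0 < α) (v v' : F) :
    ‖v - v' + (α * (‖X‖ ^ 2)⁻¹) • (X (W v) - X (W v'))‖ ^ 2 ≤
      ‖v - v'‖ ^ 2 - (α * (‖X‖ ^ 2)⁻¹) ^ 2 * ‖X (W v) - X (W v')‖ ^ 2 := by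
  have hXpos : 0 < ‖X‖ := norm_pos_iff.2 hX
  set γ := α * (‖X‖ ^ 2)⁻¹ with hγ
  have hγ0 : 0 < γ := by positivity
  have h1 : γ * ‖X (W v) - X (W v')‖ ^ 2 ≤ α * ‖W v - W v'‖ ^ 2 := by
    rw [← map_sub]
    calc γ * ‖X (W v - W v')‖ ^ 2 ≤ γ * (‖X‖ * ‖W v - W v'‖) ^ 2 := by
          gcongr; exact X.le_opNorm _
      _ = α * ‖W v - W v'‖ ^ 2 := by rw [hγ]; field_simp
  have h2 := h1.trans (hW v v')
  rw [← neg_sub v v', inner_neg_right, real_inner_comm] at h2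
  rw [norm_add_sq_real, inner_smul_right, norm_smul, Real.norm_eq_abs, mul_pow, sq_abs]
  -- The cross term supplies -2γ²‖·‖², half of which cancels the square of the step.
  have h3 := mul_le_mul_of_nonneg_left h2 hγ0.le
  nlinarith

theorem norm_gradient_step_le {X : E →L[ℝ] F} (hX : X ≠ 0) {α : ℝ} {W : F → E}
    (hW : ∀ v v', α * ‖W v - W v'‖ ^ 2 ≤ inner ℝ (X (W v) - X (W v')) (v' - v))
    (hα : 0 < α) (v v' : F) :
    ‖v - v' + (α * (‖X‖ ^ 2)⁻¹) • (X (W v) - X (W v'))‖ ≤ ‖v - v'‖ := by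
  refine (sq_le_sq₀ (norm_nonneg _) (norm_nonneg _)).1 ((norm_gradient_step_sq_le hX hW hα v v').trans ?_)
  exact sub_le_self _ (by positivity)

variable [CompleteSpace E] [CompleteSpace F] {X : E →L[ℝ] F} {R : E → EReal} {α : ℝ}

/-- Stability of dual gradient descent with respect to the data. -/
theorem norm_dgdDual_sub_le (hX : X ≠ 0) (hα : 0 < α)
    (hW : ∀ v v', α * ‖primalOfDual X R α v - primalOfDual X R α v'‖ ^ 2 ≤
      inner ℝ (X (primalOfDual X R α v) - X (primalOfDual X R α v')) (v' - v))
    {y y₀ : F} {δ : ℝ} (hy : ‖y - y₀‖ ≤ δ) (k : ℕ) :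
    ‖dgdDual X R α y k - dgdDual X R α y₀ k‖ ≤ k * (α * (‖X‖ ^ 2)⁻¹ * δ) := by
  have hγ : 0 ≤ α * (‖X‖ ^ 2)⁻¹ := by positivity
  induction k with
  | zero => simp [dgdDual]
  | succ k ih =>
    have hstep := norm_gradient_step_le hX hW hα (dgdDual X R α y k) (dgdDual X R α y₀ k)
    -- Both runs use the same gradient map; the data enter only as a shift of norm at most γδ per
    -- step.
    have hsplit : dgdDual X R α y (k + 1) - dgdDual X R α y₀ (k + 1) =
        (dgdDual X R α y k - dgdDual X R α y₀ k + (α * (‖X‖ ^ 2)⁻¹) •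
          (X (primalOfDual X R α (dgdDual X R α y k)) -
            X (primalOfDual X R α (dgdDual X R α y₀ k)))) - (α * (‖X‖ ^ 2)⁻¹) • (y - y₀) := by
      simp only [dgdDual, smul_sub]; abel
    rw [hsplit]
    refine (norm_sub_le _ _).trans ?_
    rw [norm_smul, Real.norm_of_nonneg hγ]
    push_cast
    linarith [mul_le_mul_of_nonneg_left hy hγ]

/-- The noiseless dual iterates do not move away from a stationary point. -/
theorem norm_dgdDual_sub_stationary_le (hX : X ≠ 0) (hα : 0 < α)
    (hW : ∀ v v', α * ‖primalOfDual X R α v - primalOfDual X R α v'‖ ^ 2 ≤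
      inner ℝ (X (primalOfDual X R α v) - X (primalOfDual X R α v')) (v' - v))
    (v₀ : F) (k : ℕ) :
    ‖dgdDual X R α (X (primalOfDual X R α v₀)) k - v₀‖ ≤ ‖v₀‖ := by
  induction k with
  | zero => simp [dgdDual]
  | succ k ih =>
    have hstep := norm_gradient_step_le hX hW hα
      (dgdDual X R α (X (primalOfDual X R α v₀)) k) v₀
    refine le_trans (le_of_eq ?_) (hstep.trans ih)
    simp only [dgdDual]
    congr 1; abel

/-- The residuals of dual gradient descent do not increase. -/
theorem antitone_norm_residual (hX : X ≠ 0) (hα : 0 < α)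
    (hW : ∀ v v', α * ‖primalOfDual X R α v - primalOfDual X R α v'‖ ^ 2 ≤
      inner ℝ (X (primalOfDual X R α v) - X (primalOfDual X R α v')) (v' - v)) (y : F) :
    Antitone fun k => ‖X (dgdPrimal X R α y k) - y‖ := by
  have hγ : 0 < α * (‖X‖ ^ 2)⁻¹ := by
    have := norm_pos_iff.2 hX
    positivity
  refine antitone_nat_of_succ_le fun k => ?_
  have hstep := norm_gradient_step_le hX hW hα (dgdDual X R α y (k + 1)) (dgdDual X R α y k)
  -- A dual increment is γ times a residual, so nonexpansiveness between consecutive iterates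
  -- compares consecutive residuals.
  have hdiff : dgdDual X R α y (k + 1) - dgdDual X R α y k =
      (α * (‖X‖ ^ 2)⁻¹) • (X (dgdPrimal X R α y k) - y) := by
    simp only [dgdDual, dgdPrimal]; abel
  rw [hdiff, ← smul_add, norm_smul, norm_smul] at hstep
  refine le_of_mul_le_mul_left (le_trans (le_of_eq ?_) hstep) (norm_pos_iff.2 hγ.ne')
  congr 2
  simp only [dgdPrimal]; abel

/-- Summability of the squared noiseless residuals along the noisy iterates. -/
theorem sum_sq_norm_residual_le (hX : X ≠ 0) (hα : 0 < α)
    (hW : ∀ v v', α * ‖primalOfDual X R α v - primalOfDual X R α v'‖ ^ 2 ≤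
      inner ℝ (X (primalOfDual X R α v) - X (primalOfDual X R α v')) (v' - v))
    {v₀ y : F} {δ B : ℝ} (hy : ‖y - X (primalOfDual X R α v₀)‖ ≤ δ) (k : ℕ)
    (hB : ∀ j < k, ‖dgdDual X R α y j - v₀‖ ≤ B) :
    ‖dgdDual X R α y k - v₀‖ ^ 2 + (α * (‖X‖ ^ 2)⁻¹) ^ 2 * ∑ j ∈ Finset.range k,
        ‖X (dgdPrimal X R α y j) - X (primalOfDual X R α v₀)‖ ^ 2 ≤
      ‖v₀‖ ^ 2 + k * (2 * (α * (‖X‖ ^ 2)⁻¹ * δ) * B + (α * (‖X‖ ^ 2)⁻¹ * δ) ^ 2) := by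
  induction k with
  | zero => simp [dgdDual]
  | succ k ih =>
    have ih := ih fun j hj => hB j (hj.trans (Nat.lt_succ_self k))
    have hBk := hB k (Nat.lt_succ_self k)
    set γ := α * (‖X‖ ^ 2)⁻¹ with hγ
    have hγ0 : 0 ≤ γ := by positivity
    have hstep := norm_gradient_step_sq_le hX hW hα (dgdDual X R α y k) v₀
    have hle := norm_gradient_step_le hX hW hα (dgdDual X R α y k) v₀
    rw [← hγ] at hstep hle
    set q := dgdDual X R α y k - v₀ + γ • (X (primalOfDual X R α (dgdDual X R α y k)) -
      X (primalOfDual X R α v₀)) with hq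
    have hsplit : dgdDual X R α y (k + 1) - v₀ =
        q - γ • (y - X (primalOfDual X R α v₀)) := by
      simp only [hq, hγ, dgdDual, smul_sub]; abel
    have hnoise : ‖γ • (y - X (primalOfDual X R α v₀))‖ ≤ γ * δ := by
      rw [norm_smul, Real.norm_of_nonneg hγ0]; gcongr
    have hnext : ‖dgdDual X R α y (k + 1) - v₀‖ ^ 2 ≤
        ‖q‖ ^ 2 + (2 * (γ * δ) * B + (γ * δ) ^ 2) := by
      have h1 : ‖dgdDual X R α y (k + 1) - v₀‖ ≤ ‖q‖ + γ * δ := by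
        rw [hsplit]; exact (norm_sub_le _ _).trans (by gcongr)
      have h2 := pow_le_pow_left₀ (norm_nonneg _) h1 2
      have h3 : ‖q‖ * (γ * δ) ≤ B * (γ * δ) :=
        mul_le_mul_of_nonneg_right (hle.trans hBk) ((norm_nonneg _).trans hnoise)
      linarith [h2, h3, add_sq ‖q‖ (γ * δ)]
    rw [Finset.sum_range_succ]
    push_cast
    simp only [dgdPrimal] at ih ⊢
    linarith

end Iteration

/-! ### Primal convergence for step counts of order 1/δ. -/

section Convergence

variable {E F : Type*} [NormedAddCommGroup E] [InnerProductSpace ℝ E] [CompleteSpace E]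
  [NormedAddCommGroup F] [InnerProductSpace ℝ F] [CompleteSpace F]
  {X : E →L[ℝ] F} {R : E → EReal} {α : ℝ}

theorem neg_adjoint_mem_subdiff_primalOfDual [ProperSpace E] (hR : IsGammaZero R) (hα : 0 < α)
    {w₀ u₀ : E} (hu₀ : u₀ ∈ subdiff R w₀) (v : F) :
    -(X.adjoint v) ∈ subdiff (regularized α R) (primalOfDual X R α v) :=
  hR.mem_subdiff_prox hu₀ hα _

/-- The negative of the gradient map of the dual objective is cocoercive. -/
theorem primalOfDual_cocoercive [ProperSpace E] (hR : IsGammaZero R) (hα : 0 < α)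
    {w₀ u₀ : E} (hu₀ : u₀ ∈ subdiff R w₀) (v v' : F) :
    α * ‖primalOfDual X R α v - primalOfDual X R α v'‖ ^ 2 ≤
      inner ℝ (X (primalOfDual X R α v) - X (primalOfDual X R α v')) (v' - v) := by
  have h := hR.strongly_monotone (neg_adjoint_mem_subdiff_primalOfDual (X := X) hR hα hu₀ v)
    (neg_adjoint_mem_subdiff_primalOfDual (X := X) hR hα hu₀ v')
  rwa [neg_sub_neg, ← map_sub, ContinuousLinearMap.adjoint_inner_left, real_inner_comm,
    map_sub] at h

/-- With a number of steps proportional to the inverse of the noise level, the primal iterates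
converge to the noiseless solution, uniformly in the stopping time. -/
theorem eventually_norm_dgdPrimal_sub_le (hX : X ≠ 0) (hα : 0 < α)
    (hW : ∀ v v', α * ‖primalOfDual X R α v - primalOfDual X R α v'‖ ^ 2 ≤
      inner ℝ (X (primalOfDual X R α v) - X (primalOfDual X R α v')) (v' - v))
    (v₀ : F) {a b η : ℝ} (ha : 0 < a) (hb : 0 < b) (hη : 0 < η) :
    ∀ᶠ δ in 𝓝[>] (0 : ℝ), ∀ y : F, ‖y - X (primalOfDual X R α v₀)‖ ≤ δ →
      ∀ k : ℕ, a ≤ k * δ → k * δ ≤ b →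
        ‖dgdPrimal X R α y k - primalOfDual X R α v₀‖ ≤ η := by
  set γ := α * (‖X‖ ^ 2)⁻¹ with hγ
  have hγ0 : 0 < γ := by
    have := norm_pos_iff.2 hX
    positivity
  -- B bounds the dual distance to v₀ while kδ ≤ b, C bounds γ² times the sum of squared residuals
  -- (using δ ≤ 1), and g is the resulting residual bound times B.
  set B := ‖v₀‖ + b * γ with hBdef
  set C := ‖v₀‖ ^ 2 + b * (2 * γ * B + γ ^ 2) with hC
  set g : ℝ → ℝ := fun δ => (2 * δ + √(C * δ / (a * γ ^ 2))) * B with hg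
  have hB0 : 0 ≤ B := by positivity
  have hg0 : ∀ᶠ δ in 𝓝[>] (0 : ℝ), g δ < α * η ^ 2 := by
    have hcont : Continuous g := by fun_prop
    have h0 : g 0 = 0 := by simp [hg]
    exact ((hcont.tendsto 0).mono_left nhdsWithin_le_nhds).eventually_lt_const
      (by rw [h0]; positivity)
  filter_upwards [hg0, Ioc_mem_nhdsGT (zero_lt_one' ℝ)] with δ hδg hδ y hy k hak hkb
  have hδ0 : 0 < δ := hδ.1
  have hvB : ∀ j ≤ k, ‖dgdDual X R α y j - v₀‖ ≤ B := by
    intro j hj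
    have h1 := norm_dgdDual_sub_le hX hα hW hy j
    have h2 := norm_dgdDual_sub_stationary_le hX hα hW v₀ j
    have h3 : (j : ℝ) * (γ * δ) ≤ b * γ := by
      have : (j : ℝ) ≤ k := by exact_mod_cast hj
      calc (j : ℝ) * (γ * δ) ≤ k * (γ * δ) := by gcongr
        _ = k * δ * γ := by ring
        _ ≤ b * γ := by gcongr
    refine (norm_sub_le_norm_sub_add_norm_sub _
      (dgdDual X R α (X (primalOfDual X R α v₀)) j) _).trans ?_
    rw [← hγ] at h1
    linarith
  set s := ‖X (dgdPrimal X R α y k) - X (primalOfDual X R α v₀)‖ with hs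
  have hsum := sum_sq_norm_residual_le hX hα hW hy k fun j hj => hvB j hj.le
  rw [← hγ] at hsum
  -- Monotonicity holds for residuals against y; passing to the noiseless data and back costs δ
  -- twice.
  have hterm : ∀ j ∈ Finset.range k,
      s - 2 * δ ≤ ‖X (dgdPrimal X R α y j) - X (primalOfDual X R α v₀)‖ := by
    intro j hj
    have hanti : ‖X (dgdPrimal X R α y k) - y‖ ≤ ‖X (dgdPrimal X R α y j) - y‖ :=
      antitone_norm_residual hX hα hW y (Finset.mem_range.1 hj).le
    have h1 := norm_sub_le_norm_sub_add_norm_sub (X (dgdPrimal X R α y k)) y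
      (X (primalOfDual X R α v₀))
    have h2 := norm_sub_le_norm_sub_add_norm_sub (X (dgdPrimal X R α y j))
      (X (primalOfDual X R α v₀)) y
    rw [norm_sub_rev (X (primalOfDual X R α v₀)) y] at h2
    linarith
  -- All k summands are at least (s - 2δ)² when s ≥ 2δ, and k ≥ a/δ.
  have hsg : s ≤ 2 * δ + √(C * δ / (a * γ ^ 2)) := by
    rcases le_total s (2 * δ) with hle | hle
    · exact hle.trans (le_add_of_nonneg_right (Real.sqrt_nonneg _))
    rw [← sub_le_iff_le_add']
    refine Real.le_sqrt_of_sq_le ?_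
    rw [le_div_iff₀ (by positivity)]
    have h1 : (k : ℝ) * (s - 2 * δ) ^ 2 ≤ ∑ j ∈ Finset.range k,
        ‖X (dgdPrimal X R α y j) - X (primalOfDual X R α v₀)‖ ^ 2 := by
      rw [← nsmul_eq_mul]
      refine le_trans (le_of_eq (by simp)) (Finset.card_nsmul_le_sum (Finset.range k) _
        ((s - 2 * δ) ^ 2) fun j hj => ?_)
      exact pow_le_pow_left₀ (sub_nonneg.2 hle) (hterm j hj) 2
    have h2 : (k : ℝ) * (2 * (γ * δ) * B + (γ * δ) ^ 2) ≤ b * (2 * γ * B + γ ^ 2) := by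
      have h3 : 2 * γ * B + γ ^ 2 * δ ≤ 2 * γ * B + γ ^ 2 := by
        have := mul_le_mul_of_nonneg_left hδ.2 (sq_nonneg γ)
        linarith
      calc (k : ℝ) * (2 * (γ * δ) * B + (γ * δ) ^ 2)
          = k * δ * (2 * γ * B + γ ^ 2 * δ) := by ring
        _ ≤ b * (2 * γ * B + γ ^ 2) := by gcongr
    have h4 : γ ^ 2 * (k * (s - 2 * δ) ^ 2) ≤ C := by
      have := mul_le_mul_of_nonneg_left h1 (sq_nonneg γ)
      linarith [sq_nonneg ‖dgdDual X R α y k - v₀‖]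
    calc (s - 2 * δ) ^ 2 * (a * γ ^ 2) ≤ (s - 2 * δ) ^ 2 * (k * δ * γ ^ 2) := by gcongr
      _ = γ ^ 2 * (k * (s - 2 * δ) ^ 2) * δ := by ring
      _ ≤ C * δ := by gcongr
  have hfin : α * ‖dgdPrimal X R α y k - primalOfDual X R α v₀‖ ^ 2 ≤ g δ := by
    refine (hW _ _).trans ((real_inner_le_norm _ _).trans ?_)
    rw [norm_sub_rev v₀]
    exact mul_le_mul hsg (hvB k le_rfl) (norm_nonneg _) (by positivity)
  have hsq : ‖dgdPrimal X R α y k - primalOfDual X R α v₀‖ ^ 2 ≤ η ^ 2 :=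
    le_of_mul_le_mul_left (hfin.trans hδg.le) hα
  exact (sq_le_sq₀ (norm_nonneg _) hη.le).1 hsq

end Convergence

end DGD

/-! ### Model consistency: balancing the error budget. -/

theorem theorem4p1 {n p : ℕ}
    (X : EuclideanSpace ℝ (Fin p) →L[ℝ] EuclideanSpace ℝ (Fin n)) (hX : X ≠ 0)
    (R : EuclideanSpace ℝ (Fin p) → EReal) (hR : DGD.IsGammaZero R)
    (α : ℝ) (hα : 0 < α)
    (w₀ z₀ : EuclideanSpace ℝ (Fin p)) (v₀ : EuclideanSpace ℝ (Fin n))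
    -- the ground truth is the unique solution of the noiseless problem
    (hw₀ : DGD.primalSolutions X R α (X w₀) = {w₀})
    -- the noiseless dual iterates converge to a dual solution
    (hv₀ : v₀ ∈ DGD.dualSolutions X R α (X w₀))
    (hlim : Filter.Tendsto (DGD.dgdDual X R α (X w₀)) Filter.atTop (nhds v₀))
    -- the nondegenerate source condition
    (hz₀ : z₀ = -(X.adjoint v₀))
    (hsc : z₀ ∈ intrinsicInterior ℝ (DGD.subdiff (DGD.regularized α R) w₀))
    -- partial smoothness
    (M : Set (EuclideanSpace ℝ (Fin p))) (hM : DGD.IsPartlySmooth R M w₀)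
    -- the bound on the stopping constants by a number below the distance to the boundary
    (ε : ℝ) (hε : 0 < ε) (κ : ℝ)
    (hκ : ENNReal.ofReal κ <
      Metric.infEDist (w₀ + z₀) (frontier (DGD.localUnion R α M w₀ ε)))
    (c : ℝ) (hc : 0 < c) :
    ∃ δ₀ : ℝ, 0 < δ₀ ∧
      ∀ δ : ℝ, 0 < δ → δ < δ₀ →
      ∀ y : EuclideanSpace ℝ (Fin n), ‖y - X w₀‖ ≤ δ →
      ∀ (kδ : ℕ) (cδ : ℝ), ⌊c * δ⁻¹⌋₊ ≤ kδ → kδ ≤ 2 * ⌊c * δ⁻¹⌋₊ →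
        (kδ : ℝ) = cδ * δ⁻¹ → α * cδ * ‖X‖⁻¹ ≤ κ →
        DGD.dgdPrimal X R α y kδ ∈ M ∧
        ∃ k₁ k₂ : ℕ, 0 < k₁ ∧ k₁ < kδ ∧ kδ < k₂ ∧
          ∀ k : ℕ, k₁ ≤ k → k ≤ k₂ → DGD.dgdPrimal X R α y k ∈ M := by
  have hXpos : 0 < ‖X‖ := norm_pos_iff.2 hX
  obtain ⟨u₀, hu₀⟩ := hM.nonempty_subdiff
  have hz₀mem := intrinsicInterior_subset hsc
  have hmem := fun v => DGD.neg_adjoint_mem_subdiff_primalOfDual (X := X) hR hα hu₀ v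
  have hW := DGD.primalOfDual_cocoercive (X := X) hR hα hu₀
  -- Both points have z₀ as a subgradient of R_α, and strong monotonicity allows only one such
  -- point.
  have hWv₀ : DGD.primalOfDual X R α v₀ = w₀ := by
    have h := hR.strongly_monotone (hmem v₀) hz₀mem
    rw [hz₀, sub_self, inner_zero_left] at h
    have : ‖DGD.primalOfDual X R α v₀ - w₀‖ ^ 2 = 0 :=
      le_antisymm (nonpos_of_mul_nonpos_right h hα) (sq_nonneg _)
    simpa [sub_eq_zero] using this
  -- The distance may be infinite, so a finite t in between fixes the slack. Of its four shares η,
  -- one pays for the primal error, one for the noiseless dual error and one for a step past `kδ`;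
  -- the last is spare.
  obtain ⟨t, hκt, htd⟩ := exists_between hκ
  have ht : t ≠ ⊤ := htd.ne_top
  have hκt' : κ < t.toReal := by
    by_contra! hle
    exact absurd hκt (not_lt.2 ((ENNReal.ofReal_toReal ht).symm.le.trans
      (ENNReal.ofReal_le_ofReal hle)))
  set η := (t.toReal - κ) / 4 with hη
  have hη0 : 0 < η := by rw [hη]; linarith
  -- The window [c/2, 3c] contains kδ for k within one of the stopping time, once δ < c/4.
  have hconv := DGD.eventually_norm_dgdPrimal_sub_le hX hα hW v₀
    (half_pos hc) (by positivity : 0 < 3 * c) hη0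
  rw [hWv₀] at hconv
  obtain ⟨N, hN⟩ := (Metric.tendsto_atTop.1 hlim) (η / ‖X‖) (by positivity)
  have hsmall : ∀ᶠ δ in 𝓝[>] (0 : ℝ), δ * (α * ‖X‖⁻¹) < η ∧ δ * N < c / 2 ∧ δ < c / 4 := by
    have hlin : ∀ q r : ℝ, 0 < r → ∀ᶠ δ in 𝓝[>] (0 : ℝ), δ * q < r := fun q r hr => by
      have hcont : Continuous fun δ : ℝ => δ * q := by fun_prop
      exact ((hcont.tendsto 0).mono_left nhdsWithin_le_nhds).eventually_lt_const (by simpa using hr)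
    filter_upwards [hlin (α * ‖X‖⁻¹) η hη0, hlin N (c / 2) (half_pos hc),
      hlin 1 (c / 4) (by positivity)] with δ h1 h2 h3
    exact ⟨h1, h2, by simpa using h3⟩
  obtain ⟨δ₀, hδ₀, hall⟩ := mem_nhdsGT_iff_exists_Ioo_subset.1 (hconv.and hsmall)
  refine ⟨δ₀, hδ₀, fun δ hδ0 hδ y hy kδ cδ hk1 hk2 hkc hcκ => ?_⟩
  obtain ⟨hprimal, hδη, hδN, hδc⟩ := hall ⟨hδ0, hδ⟩
  have hcδ : cδ = kδ * δ := by rw [hkc]; field_simp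
  have hlow : c ≤ (kδ + 1) * δ := by
    have h1 : c * δ⁻¹ < (kδ : ℝ) + 1 := (Nat.lt_floor_add_one _).trans_le (by
      have : (⌊c * δ⁻¹⌋₊ : ℝ) ≤ kδ := by exact_mod_cast hk1
      linarith)
    rw [← div_eq_mul_inv, div_lt_iff₀ hδ0] at h1
    exact h1.le
  have hup : kδ * δ ≤ 2 * c := by
    have h1 : (kδ : ℝ) ≤ 2 * (c * δ⁻¹) := by
      have h2 : (kδ : ℝ) ≤ 2 * (⌊c * δ⁻¹⌋₊ : ℝ) := by exact_mod_cast hk2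
      linarith [Nat.floor_le (by positivity : 0 ≤ c * δ⁻¹)]
    calc kδ * δ ≤ 2 * (c * δ⁻¹) * δ := by gcongr
      _ = 2 * c := by field_simp
  have hcore : ∀ k : ℕ, kδ ≤ k + 1 → k ≤ kδ + 1 → DGD.dgdPrimal X R α y k ∈ M := by
    intro k hkl hku
    have hkl' : (kδ : ℝ) ≤ k + 1 := by exact_mod_cast hkl
    have hku' : (k : ℝ) ≤ kδ + 1 := by exact_mod_cast hku
    have hkδl : c / 2 ≤ k * δ := by
      have := mul_le_mul_of_nonneg_right hkl' hδ0.le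
      linarith
    have hkδu : k * δ ≤ (kδ + 1) * δ := by gcongr
    have hw : ‖DGD.dgdPrimal X R α y k - w₀‖ ≤ η := hprimal y hy k hkδl (by linarith)
    have hNk : N ≤ k := by
      have : (N : ℝ) * δ ≤ k * δ := by linarith
      exact_mod_cast le_of_mul_le_mul_right this hδ0
    have hv : ‖DGD.dgdDual X R α (X w₀) k - v₀‖ ≤ η / ‖X‖ := by
      rw [← dist_eq_norm]; exact (hN k hNk).le
    have hstab := DGD.norm_dgdDual_sub_le hX hα hW hy k
    have hz : ‖-(X.adjoint (DGD.dgdDual X R α y k)) - z₀‖ ≤ κ + 2 * η := by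
      rw [hz₀, neg_sub_neg, ← map_sub]
      refine (X.adjoint.le_opNorm _).trans ?_
      rw [LinearIsometryEquiv.norm_map, norm_sub_rev]
      calc ‖X‖ * ‖DGD.dgdDual X R α y k - v₀‖
          ≤ ‖X‖ * (k * (α * (‖X‖ ^ 2)⁻¹ * δ) + η / ‖X‖) := by
            gcongr
            exact (norm_sub_le_norm_sub_add_norm_sub _ (DGD.dgdDual X R α (X w₀) k) _).trans
              (add_le_add hstab hv)
        -- One factor ‖X‖ cancels, leaving the drift that the bound on `cδ` controls.
        _ = k * δ * (α * ‖X‖⁻¹) + η := by field_simp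
        _ ≤ (kδ + 1) * δ * (α * ‖X‖⁻¹) + η := by gcongr
        _ = α * cδ * ‖X‖⁻¹ + δ * (α * ‖X‖⁻¹) + η := by rw [hcδ]; ring
        _ ≤ κ + 2 * η := by linarith
    refine hR.mem_of_edist_lt_frontier_localUnion hα hε hM.manifold.1 hz₀mem
      (hmem (DGD.dgdDual X R α y k)) (lt_of_le_of_lt ?_ htd)
    rw [edist_comm, edist_dist, dist_eq_norm, add_sub_add_comm]
    refine ENNReal.ofReal_le_of_le_toReal ((norm_add_le _ _).trans ?_)
    have hw' : ‖DGD.primalOfDual X R α (DGD.dgdDual X R α y k) - w₀‖ ≤ η := hw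
    have h4 : 4 * η = t.toReal - κ := by rw [hη]; ring
    linarith
  -- This makes the lower endpoint `kδ - 1` positive.
  have hkδ : 2 ≤ kδ := by
    by_contra! hlt
    have h1 : (kδ : ℝ) + 1 ≤ 2 := by exact_mod_cast hlt
    have := mul_le_mul_of_nonneg_right h1 hδ0.le
    linarith
  refine ⟨hcore kδ (by omega) (by omega), kδ - 1, kδ + 1, by omega, by omega, by omega,
    fun k h1 h2 => hcore k (by omega) (by omega)⟩
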